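/- Let $L$ be a complete, completely distributive lattice with join $\vee$ and meet $\wedge$, and let $G$ be a group with identity $e$. For a map $\mu:G\to L$ put $\mathrm{tip}(\mu)=\bigvee_{x\in G}\mu(x)$ and $\mathrm{tail}(\mu)=\bigwedge_{x\in G}\mu(x)$. A map $\mu:G\to L$ is an $L$-subgroup of $G$ (also called an $L$-group) if $\mu(xy)\ge\mu(x)\wedge\mu(y)$ and $\mu(x^{-1})=\mu(x)$ for all $x,y\in G$. If $\eta,\mu$ are $L$-subgroups of $G$ with $\eta(x)\le\mu(x)$ for all $x$, then $\eta$ is an $L$-subgroup of $\mu$; it is normal in $\mu$, written $\eta\lhd\mu$, if moreover $\eta(yxy^{-1})\ge\eta(x)\wedge\mu(y)$ for all $x,y\in G$. For $\chi:G\to L$ let $\langle\chi\rangle$ be the pointwise infimum of all $L$-subgroups of $G$ that are pointwise $\ge\chi$. *Nilpotency.* For $\eta,\theta:G\to L$ let $(\eta,\theta)(x)=\bigvee\{\eta(y)\wedge\theta(z): y,z\in G,\ x=[y,z]\}$ if $x$ is a commutator in $G$, and $(\eta,\theta)(x)=\mathrm{tail}(\eta)\wedge\mathrm{tail}(\theta)$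 otherwise; put $[\eta,\theta]=\langle(\eta,\theta)\rangle$. The descending central chain of an $L$-group $\mu$ is $Z_0(\mu)=\mu$, $Z_{i+1}(\mu)=[Z_i(\mu),\mu]$. The $L$-group $\mu$ is nilpotent if $\mathrm{tip}(\mu)\ne\mathrm{tail}(\mu)$ and, for some $c\ge 0$, $Z_c(\mu)$ is the trivial $L$-subgroup of $\mu$, which takes the value $\mathrm{tip}(\mu)$ at $e$ and $\mathrm{tail}(\mu)$ at every $x\ne e$. *Subnormality.* Let $\eta$ be an $L$-subgroup of $\mu$. The normal closure of $\eta$ in $\mu$ is $\eta^{\mu}=\langle\mu\eta\mu^{-1}\rangle$, where $\mu\eta\mu^{-1}(x)=\bigvee\{\eta(y)\wedge\mu(z): y,z\in G,\ x=zyz^{-1}\}$. The normal closure series of $\eta$ in $\mu$ is $\eta_0=\mu$, $\eta_{i+1}=\eta^{\eta_i}$. The $L$-subgroup $\eta$ is subnormal in $\mu$ if there is an integer $m\ge0$ with $\eta=\eta_m\lhd\eta_{m-1}\lhd\cdots\lhd\eta_0=\mu$. **Theorem.** Let $\mu$ be a nilpotent $L$-group and let $\eta$ be an $L$-subgroup of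 $\mu$ with $\mathrm{tip}(\eta)=\mathrm{tip}(\mu)$ and $\mathrm{tail}(\eta)=\mathrm{tail}(\mu)$. Then $\eta$ is a subnormal $L$-subgroup of $\mu$. -/

import Mathlib

namespace LGroup

/-- The tip of an `L`-subset: the supremum of its values. -/
def tip {X L : Type*} [CompleteLattice L] (μ : X → L) : L := ⨆ x, μ x

/-- The tail of an `L`-subset: the infimum of its values. -/
def tail {X L : Type*} [CompleteLattice L] (μ : X → L) : L := ⨅ x, μ x

/-- `μ` is an `L`-subgroup of the group `G`, that is, `μ ∈ L(G)`. -/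
structure IsLSubgroup {G L : Type*} [Group G] [CompleteLattice L] (μ : G → L) : Prop where
  mul_mem : ∀ x y : G, μ x ⊓ μ y ≤ μ (x * y)
  inv_eq : ∀ x : G, μ x⁻¹ = μ x

/-- `η` is an `L`-subgroup of the `L`-group `μ`, that is, `η ∈ L(μ)`. -/
structure IsLSubgroupOf {G L : Type*} [Group G] [CompleteLattice L] (η μ : G → L) : Prop where
  isLSubgroup : IsLSubgroup η
  isLSubgroup_parent : IsLSubgroup μ
  le : ∀ x : G, η x ≤ μ x

/-- `η` is a normal `L`-subgroup of the `L`-group `μ`. -/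
structure IsNormalIn {G L : Type*} [Group G] [CompleteLattice L] (η μ : G → L) : Prop where
  isLSubgroupOf : IsLSubgroupOf η μ
  conj_mem : ∀ x y : G, η x ⊓ μ y ≤ η (y * x * y⁻¹)

/-- The `L`-subgroup generated by an `L`-subset `χ`: the (pointwise) intersection of all
`L`-subgroups of `G` that contain `χ`. -/
def generated {G L : Type*} [Group G] [CompleteLattice L] (χ : G → L) : G → L :=
  fun x => ⨅ (ν : G → L) (_ : IsLSubgroup ν ∧ ∀ y, χ y ≤ ν y), ν x

/-- The trivial `L`-subgroup of `η`: the tip of `η` at the identity, the tail of `η` elsewhere. -/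
noncomputable def trivialLSubgroup {G L : Type*} [Group G] [CompleteLattice L] (η : G → L) :
    G → L :=
  open Classical in fun x => if x = 1 then tip η else tail η

/-- The commutator `L`-subset `(η, θ)`, with group commutators `[y, z] = y z y⁻¹ z⁻¹`. -/
noncomputable def commutatorSubset {G L : Type*} [Group G] [CompleteLattice L] (η θ : G → L) :
    G → L :=
  open Classical in fun x =>
    if ∃ y z : G, x = y * z * y⁻¹ * z⁻¹ then
      ⨆ (y : G) (z : G) (_ : x = y * z * y⁻¹ * z⁻¹), η y ⊓ θ z
    else tail η ⊓ tail θ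

/-- The commutator `L`-subgroup `[η, θ]`. -/
noncomputable def commutatorLSubgroup {G L : Type*} [Group G] [CompleteLattice L]
    (η θ : G → L) : G → L :=
  generated (commutatorSubset η θ)

/-- The descending central chain: `Z₀(η) = η`, `Zᵢ₊₁(η) = [Zᵢ(η), η]`. -/
noncomputable def descendingCentralChain {G L : Type*} [Group G] [CompleteLattice L]
    (η : G → L) : ℕ → G → L
  | 0 => η
  | i + 1 => commutatorLSubgroup (descendingCentralChain η i) η

/-- `μ` is a nilpotent `L`-group: an `L`-subgroup of `G` with distinct tip and tail whose
descending central chain reaches its trivial `L`-subgroup in finitely many steps. -/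
structure IsNilpotent {G L : Type*} [Group G] [CompleteLattice L] (μ : G → L) : Prop where
  isLSubgroup : IsLSubgroup μ
  tip_ne_tail : tip μ ≠ tail μ
  terminates : ∃ c : ℕ, descendingCentralChain μ c = trivialLSubgroup μ

/-- The conjugate `L`-subset `μημ⁻¹` of `η` in `μ`. -/
def conjugateSubset {G L : Type*} [Group G] [CompleteLattice L] (η μ : G → L) : G → L :=
  fun x => ⨆ (y : G) (z : G) (_ : x = z * y * z⁻¹), η y ⊓ μ z

/-- The normal closure `η^μ` of `η` in `μ`. -/
def normalClosure {G L : Type*} [Group G] [CompleteLattice L] (η μ : G → L) : G → L :=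
  generated (conjugateSubset η μ)

/-- The normal closure series of `η` in `μ`: `η₀ = μ`, and `ηᵢ₊₁` is the normal closure of `η`
in `ηᵢ`. -/
def normalClosureSeries {G L : Type*} [Group G] [CompleteLattice L] (η μ : G → L) : ℕ → G → L
  | 0 => μ
  | i + 1 => normalClosure η (normalClosureSeries η μ i)

/-- `η` is a subnormal `L`-subgroup of `μ`: for some `m`, the normal closure series satisfies
`η = ηₘ ◁ ηₘ₋₁ ◁ ⋯ ◁ η₀ = μ`. -/
structure IsSubnormalIn {G L : Type*} [Group G] [CompleteLattice L] (η μ : G → L) : Prop where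
  isLSubgroupOf : IsLSubgroupOf η μ
  exists_defect : ∃ m : ℕ, normalClosureSeries η μ m = η ∧
    ∀ i < m, IsNormalIn (normalClosureSeries η μ (i + 1)) (normalClosureSeries η μ i)

end LGroup

/-!
The classical argument for nilpotent groups carries over pointwise. Write `Zᵢ` for the descending
central chain of `μ`, `ηᵢ` for the normal closure series of `η` in `μ`, and `η ∘ Zᵢ` for the
sup-product. The key estimate, `normalClosureSeries_le_setProduct`, is `ηᵢ ≤ η ∘ Zᵢ` for every `i`.

For `i = 0` it holds because `η 1 = tip η = tip μ`. For the step, `η ∘ Zᵢ₊₁` is an `L`-subgroup,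
since `Zᵢ₊₁` is invariant under conjugation by `μ`, so it suffices to bound the conjugates of `η`
by `ηᵢ ≤ η ∘ Zᵢ`. These are controlled by the identity
`(a * b) * y * (a * b)⁻¹ = (a * y * a⁻¹) * (a * [b, y⁻¹]⁻¹ * a⁻¹)`: up to conjugation by `a`, where
`η` is large, conjugating `y` by `b` changes it only by a commutator with an entry `b` from `Zᵢ`,
and such a commutator belongs to `Zᵢ₊₁ = [Zᵢ, μ]`.

When `Z_c` is the trivial `L`-subgroup, `η ∘ Z_c ≤ η` because `tail μ = tail η ≤ η`; hence
`η_c = η`. Each `ηᵢ₊₁` is normal in `ηᵢ` by `conj_generated`: an `L`-subset invariant under conjugation by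
some other one generates an `L`-subgroup that is invariant as well. Its proof uses Heyting
implication, so that no description of `generated` by words is needed.
-/

namespace LGroup

variable {G L : Type*} [Group G]

/-! ### `L`-subgroups and generation in a complete lattice -/

section CompleteLattice

variable [CompleteLattice L] {μ η χ ν : G → L}

theorem IsLSubgroup.le_one (hμ : IsLSubgroup μ) (x : G) : μ x ≤ μ 1 := by
  simpa [hμ.inv_eq x] using hμ.mul_mem x x⁻¹

theorem IsLSubgroup.tip_eq (hμ : IsLSubgroup μ) : tip μ = μ 1 :=
  le_antisymm (iSup_le hμ.le_one) (le_iSup μ 1)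

theorem IsLSubgroup.of_le_inv (hmul : ∀ x y, μ x ⊓ μ y ≤ μ (x * y))
    (hinv : ∀ x, μ x ≤ μ x⁻¹) : IsLSubgroup μ :=
  ⟨hmul, fun x => le_antisymm (by simpa using hinv x⁻¹) (hinv x)⟩

theorem le_generated (χ : G → L) (x : G) : χ x ≤ generated χ x :=
  le_iInf₂ fun _ hν => hν.2 x

theorem generated_le (hν : IsLSubgroup ν) (h : ∀ x, χ x ≤ ν x) (x : G) :
    generated χ x ≤ ν x :=
  iInf₂_le ν ⟨hν, h⟩

theorem isLSubgroup_generated (χ : G → L) : IsLSubgroup (generated χ) :=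
  .of_le_inv
    (fun x y => le_iInf₂ fun _ hν =>
      (inf_le_inf (generated_le hν.1 hν.2 x) (generated_le hν.1 hν.2 y)).trans (hν.1.mul_mem x y))
    (fun x => le_iInf₂ fun _ hν => (generated_le hν.1 hν.2 x).trans (hν.1.inv_eq x).ge)

theorem le_conjugateSubset (η μ : G → L) (y z : G) :
    η y ⊓ μ z ≤ conjugateSubset η μ (z * y * z⁻¹) :=
  le_iSup₂_of_le y z (le_iSup_of_le rfl le_rfl)

theorem le_commutatorSubset (η θ : G → L) (y z : G) :
    η y ⊓ θ z ≤ commutatorSubset η θ (y * z * y⁻¹ * z⁻¹) := by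
  rw [commutatorSubset, if_pos ⟨y, z, rfl⟩]
  exact le_iSup₂_of_le y z (le_iSup_of_le rfl le_rfl)

theorem le_commutatorLSubgroup (η θ : G → L) (y z : G) :
    η y ⊓ θ z ≤ commutatorLSubgroup η θ (y * z * y⁻¹ * z⁻¹) :=
  (le_commutatorSubset η θ y z).trans (le_generated _ _)

theorem isLSubgroup_normalClosure (η μ : G → L) : IsLSubgroup (normalClosure η μ) :=
  isLSubgroup_generated _

theorem isLSubgroup_commutatorLSubgroup (η θ : G → L) :
    IsLSubgroup (commutatorLSubgroup η θ) :=
  isLSubgroup_generated _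

theorem IsLSubgroup.conj_mem (hμ : IsLSubgroup μ) (x y : G) :
    μ x ⊓ μ y ≤ μ (y * x * y⁻¹) := by
  refine le_trans (le_inf ?_ ?_) (hμ.mul_mem (y * x) y⁻¹)
  · exact inf_comm (μ x) (μ y) ▸ hμ.mul_mem y x
  · exact inf_le_right.trans (hμ.inv_eq y).ge

theorem IsLSubgroupOf.le_normalClosure (h : IsLSubgroupOf η μ) (x : G) :
    η x ≤ normalClosure η μ x := by
  have h1 : η x ≤ η x ⊓ μ 1 := le_inf le_rfl ((h.le x).trans (h.isLSubgroup_parent.le_one x))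
  have h2 := le_conjugateSubset η μ x 1
  rw [one_mul, inv_one, mul_one] at h2
  exact h1.trans (h2.trans (le_generated _ _))

theorem IsLSubgroupOf.normalClosure_le (h : IsLSubgroupOf η μ) (x : G) :
    normalClosure η μ x ≤ μ x := by
  refine generated_le h.isLSubgroup_parent (fun x => ?_) x
  refine iSup₂_le fun y z => iSup_le fun hx => ?_
  subst hx
  exact (inf_le_inf_right _ (h.le y)).trans (h.isLSubgroup_parent.conj_mem y z)

theorem IsLSubgroupOf.normalClosureSeries (h : IsLSubgroupOf η μ) (i : ℕ) :
    IsLSubgroupOf η (normalClosureSeries η μ i) := by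
  induction i with
  | zero => exact h
  | succ i ih => exact ⟨h.isLSubgroup, isLSubgroup_normalClosure _ _, ih.le_normalClosure⟩

/-- The sup-product `η ∘ θ`, with value `⨆ {η a ⊓ θ b | x = a * b}` at `x`; the second factor
is written as `b = a⁻¹ * x`. -/
def setProduct (η θ : G → L) : G → L := fun x => ⨆ a : G, η a ⊓ θ (a⁻¹ * x)

theorem le_setProduct (η θ : G → L) (a b : G) : η a ⊓ θ b ≤ setProduct η θ (a * b) :=
  le_iSup_of_le a (by rw [inv_mul_cancel_left])

theorem setProduct_le {θ : G → L} {x : G} {t : L}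
    (h : ∀ a b, x = a * b → η a ⊓ θ b ≤ t) : setProduct η θ x ≤ t :=
  iSup_le fun a => h a _ (mul_inv_cancel_left a x).symm

end CompleteLattice

/-! ### Conjugation invariance in a frame -/

section Frame

variable [Order.Frame L] {μ η χ θ : G → L}

/-- If `χ` is invariant under conjugation by `μ`, then so is the `L`-subgroup it generates: the
`L`-subset `x ↦ ⨅ y, μ y ⇨ generated χ (y * x * y⁻¹)` is an `L`-subgroup containing `χ`. -/
theorem conj_generated (hχ : ∀ x y, χ x ⊓ μ y ≤ χ (y * x * y⁻¹)) (x y : G) :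
    generated χ x ⊓ μ y ≤ generated χ (y * x * y⁻¹) := by
  have hg := isLSubgroup_generated χ
  have key : IsLSubgroup fun x => ⨅ y, μ y ⇨ generated χ (y * x * y⁻¹) := by
    refine .of_le_inv (fun a b => le_iInf fun z => le_himp_iff.2 ?_)
      (fun a => iInf_mono fun z => himp_le_himp_left ?_)
    · have ha : (⨅ y, μ y ⇨ generated χ (y * a * y⁻¹)) ⊓ μ z ≤ generated χ (z * a * z⁻¹) :=
        le_himp_iff.1 (iInf_le _ z)
      have hb : (⨅ y, μ y ⇨ generated χ (y * b * y⁻¹)) ⊓ μ z ≤ generated χ (z * b * z⁻¹) :=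
        le_himp_iff.1 (iInf_le _ z)
      rw [inf_inf_distrib_right]
      refine (inf_le_inf ha hb).trans ((hg.mul_mem _ _).trans_eq ?_)
      congr 1
      group
    · rw [← hg.inv_eq]
      exact le_of_eq (by congr 1; group)
  exact le_himp_iff.1 ((generated_le key (fun a => le_iInf fun z =>
    le_himp_iff.2 ((hχ a z).trans (le_generated _ _))) x).trans (iInf_le _ y))

theorem IsLSubgroup.conj_conjugateSubset (hμ : IsLSubgroup μ) (η : G → L) (x y : G) :
    conjugateSubset η μ x ⊓ μ y ≤ conjugateSubset η μ (y * x * y⁻¹) := by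
  simp only [conjugateSubset.eq_def η μ x, iSup_inf_eq]
  refine iSup₂_le fun a z => iSup_le fun hx => ?_
  subst hx
  have h := le_conjugateSubset η μ a (y * z)
  rw [show y * z * a * (y * z)⁻¹ = y * (z * a * z⁻¹) * y⁻¹ by group] at h
  refine le_trans (le_inf (inf_le_left.trans inf_le_left) ?_) h
  exact (le_inf inf_le_right (inf_le_left.trans inf_le_right)).trans (hμ.mul_mem y z)

theorem IsLSubgroupOf.isNormalIn_normalClosure (h : IsLSubgroupOf η μ) :
    IsNormalIn (normalClosure η μ) μ :=
  ⟨⟨isLSubgroup_normalClosure _ _, h.isLSubgroup_parent, h.normalClosure_le⟩,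
    conj_generated (h.isLSubgroup_parent.conj_conjugateSubset η)⟩

/-- The commutator `L`-subset of two `μ`-invariant `L`-subsets is `μ`-invariant. Conjugation
preserves the property of being a commutator, so the two cases of the definition do not mix. -/
theorem conj_commutatorSubset (hη : ∀ x y, η x ⊓ μ y ≤ η (y * x * y⁻¹))
    (hθ : ∀ x y, θ x ⊓ μ y ≤ θ (y * x * y⁻¹)) (x y : G) :
    commutatorSubset η θ x ⊓ μ y ≤ commutatorSubset η θ (y * x * y⁻¹) := by
  by_cases hx : ∃ a b : G, x = a * b * a⁻¹ * b⁻¹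
  · simp only [commutatorSubset.eq_def η θ x, if_pos hx, iSup_inf_eq]
    refine iSup₂_le fun a b => iSup_le fun hab => ?_
    subst hab
    have h := le_commutatorSubset η θ (y * a * y⁻¹) (y * b * y⁻¹)
    rw [show y * a * y⁻¹ * (y * b * y⁻¹) * (y * a * y⁻¹)⁻¹ * (y * b * y⁻¹)⁻¹
      = y * (a * b * a⁻¹ * b⁻¹) * y⁻¹ by group] at h
    rw [inf_inf_distrib_right]
    exact (inf_le_inf (hη a y) (hθ b y)).trans h
  · have hyx : ¬ ∃ a b : G, y * x * y⁻¹ = a * b * a⁻¹ * b⁻¹ := by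
      rintro ⟨a, b, hab⟩
      refine hx ⟨y⁻¹ * a * y, y⁻¹ * b * y, ?_⟩
      calc x = y⁻¹ * (y * x * y⁻¹) * y := by group
        _ = _ := by rw [hab]; group
    rw [commutatorSubset, commutatorSubset, if_neg hx, if_neg hyx]
    exact inf_le_left

theorem IsLSubgroup.descendingCentralChain (hμ : IsLSubgroup μ) (i : ℕ) :
    IsLSubgroup (descendingCentralChain μ i) := by
  cases i with
  | zero => exact hμ
  | succ i => exact isLSubgroup_commutatorLSubgroup _ _

theorem IsLSubgroup.conj_descendingCentralChain (hμ : IsLSubgroup μ) (i : ℕ) (x y : G) :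
    LGroup.descendingCentralChain μ i x ⊓ μ y ≤
      LGroup.descendingCentralChain μ i (y * x * y⁻¹) := by
  induction i generalizing x y with
  | zero => exact hμ.conj_mem x y
  | succ i ih => exact conj_generated (conj_commutatorSubset ih hμ.conj_mem) x y

/-- The product of two `L`-subgroups is an `L`-subgroup if the first normalizes the second. -/
theorem IsLSubgroup.setProduct (hη : IsLSubgroup η) (hθ : IsLSubgroup θ)
    (hconj : ∀ x y, θ x ⊓ η y ≤ θ (y * x * y⁻¹)) : IsLSubgroup (setProduct η θ) := by
  have hconj' (a b : G) : η a ⊓ θ b ≤ θ (a⁻¹ * b * a) := by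
    simpa [hη.inv_eq, inf_comm] using hconj b a⁻¹
  refine .of_le_inv (fun x y => ?_) (fun x => setProduct_le fun a b hx => ?_)
  · rw [LGroup.setProduct, iSup_inf_eq]
    refine iSup_le fun a => ?_
    rw [LGroup.setProduct, inf_iSup_eq]
    refine iSup_le fun a' => ?_
    have h := le_setProduct η θ (a * a') (a'⁻¹ * (a⁻¹ * x) * a' * (a'⁻¹ * y))
    rw [show a * a' * (a'⁻¹ * (a⁻¹ * x) * a' * (a'⁻¹ * y)) = x * y by group] at h
    refine le_trans (le_inf ?_ ?_) h
    · exact (inf_le_inf inf_le_left inf_le_left).trans (hη.mul_mem a a')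
    · refine le_trans (le_inf ?_ (inf_le_right.trans inf_le_right)) (hθ.mul_mem _ _)
      exact (le_inf (inf_le_right.trans inf_le_left) (inf_le_left.trans inf_le_right)).trans
        (hconj' a' _)
  · subst hx
    have h := le_setProduct η θ a⁻¹ (a * b⁻¹ * a⁻¹)
    rw [show a⁻¹ * (a * b⁻¹ * a⁻¹) = (a * b)⁻¹ by group, hη.inv_eq] at h
    refine le_trans (le_inf inf_le_left ?_) h
    simpa [hθ.inv_eq, inf_comm] using hconj b⁻¹ a

/-! ### Nilpotency and subnormality -/

/-- The key estimate `ηᵢ ≤ η ∘ Zᵢ`: the normal closure series of `η` approaches `η` as fast as the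
descending central chain approaches the trivial `L`-subgroup. -/
theorem normalClosureSeries_le_setProduct (h : IsLSubgroupOf η μ) (htip : tip η = tip μ)
    (i : ℕ) (x : G) :
    normalClosureSeries η μ i x ≤ setProduct η (descendingCentralChain μ i) x := by
  have hμ := h.isLSubgroup_parent
  induction i generalizing x with
  | zero =>
    have h1 : μ x ≤ η 1 := (le_iSup μ x).trans (htip.symm.trans h.isLSubgroup.tip_eq).le
    have h2 := le_setProduct η μ 1 x
    rw [one_mul] at h2
    exact (le_inf h1 le_rfl).trans h2
  | succ i ih =>
    have hconj := hμ.conj_descendingCentralChain (i + 1)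
    have hZ := hμ.descendingCentralChain (i + 1)
    refine generated_le (h.isLSubgroup.setProduct hZ fun x y =>
      (inf_le_inf_left _ (h.le y)).trans (hconj x y)) (fun x => ?_) x
    refine iSup₂_le fun y z => iSup_le fun hx => ?_
    subst hx
    refine (inf_le_inf_left _ (ih z)).trans ?_
    rw [setProduct, inf_iSup_eq]
    refine iSup_le fun a => ?_
    obtain ⟨b, rfl⟩ : ∃ b, z = a * b := ⟨a⁻¹ * z, by group⟩
    rw [inv_mul_cancel_left]
    -- `η` is below `μ`, so the commutator of `b` with `y⁻¹` lies in `[Zᵢ, μ]` to this degree.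
    have hcomm : η y ⊓ (η a ⊓ descendingCentralChain μ i b) ≤
        descendingCentralChain μ (i + 1) (b * y⁻¹ * b⁻¹ * y⁻¹⁻¹)⁻¹ := by
      rw [hZ.inv_eq]
      refine le_trans (le_inf (inf_le_right.trans inf_le_right) ?_)
        (le_commutatorLSubgroup (descendingCentralChain μ i) μ b y⁻¹)
      exact inf_le_left.trans ((h.le y).trans (hμ.inv_eq y).ge)
    have hp := le_setProduct η (descendingCentralChain μ (i + 1)) (a * y * a⁻¹)
      (a * (b * y⁻¹ * b⁻¹ * y⁻¹⁻¹)⁻¹ * a⁻¹)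
    rw [show a * y * a⁻¹ * (a * (b * y⁻¹ * b⁻¹ * y⁻¹⁻¹)⁻¹ * a⁻¹) = a * b * y * (a * b)⁻¹ by
      group] at hp
    refine le_trans (le_inf ?_ ?_) hp
    · exact (inf_le_inf_left _ inf_le_left).trans (h.isLSubgroup.conj_mem y a)
    · exact (le_inf hcomm ((inf_le_right.trans inf_le_left).trans (h.le a))).trans (hconj _ a)

/-- Factorizations `x = a * b` with `b ≠ 1` contribute at most `tail η`, which is where equality of
the tails is needed. -/
theorem setProduct_trivialLSubgroup_le (htail : tail η = tail μ) (x : G) :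
    setProduct η (trivialLSubgroup μ) x ≤ η x := by
  refine setProduct_le fun a b hx => ?_
  by_cases hb : b = 1
  · subst hb
    rw [hx, mul_one]
    exact inf_le_left
  · rw [trivialLSubgroup, if_neg hb, ← htail]
    exact inf_le_right.trans (iInf_le η x)

end Frame

end LGroup

theorem mainTheorem3 {G L : Type*} [Group G] [CompletelyDistribLattice L] (μ η : G → L)
    (hμ : LGroup.IsNilpotent μ) (hη : LGroup.IsLSubgroupOf η μ)
    (htip : LGroup.tip η = LGroup.tip μ) (htail : LGroup.tail η = LGroup.tail μ) :
    LGroup.IsSubnormalIn η μ := by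
  obtain ⟨c, hc⟩ := hμ.terminates
  refine ⟨hη, c, funext fun x => le_antisymm ?_ ((hη.normalClosureSeries c).le x), fun i _ =>
    (hη.normalClosureSeries i).isNormalIn_normalClosure⟩
  have h := LGroup.normalClosureSeries_le_setProduct hη htip c x
  rw [hc] at h
  exact h.trans (LGroup.setProduct_trivialLSubgroup_le htail x)
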